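/- Let $\mu$ be the coin-tossing probability measure on the Cantor space $2^{\omega}$, i.e. $\mu(N_s)=2^{-\mathrm{lh}(s)}$ for every finite binary sequence $s$, where $N_s=\{x\in 2^\omega : s\subset x\}$. Let $\mathcal K$ be the space of all compact subsets of $2^\omega$ (including $\emptyset$) with the Vietoris topology. For $K\in\mathcal K$ and $z\in 2^\omega$ let $$\mathcal D^-_K(z)=\liminf_{n\to\infty}\frac{\mu(K\cap N_{z\restriction n})}{\mu(N_{z\restriction n})},\qquad \mathcal D_K(z)=\lim_{n\to\infty}\frac{\mu(K\cap N_{z\restriction n})}{\mu(N_{z\restriction n})}\ \text{(when the limit exists)}.$$ For $\bowtie$ one of $<,>,\le,\ge$ put $$\mathcal A_{\bowtie}=\{(K,z,n,r)\in\mathcal K\times 2^\omega\times\omega\times[0,1] : \mu(K\cap N_{z\restriction n})\bowtie r\},\qquad \mathcal B^-_{\bowtie}=\{(K,z,r)\in\mathcal K\times 2^\omega\times[0,1] : \mathcal D^-_K(z)\bowtie r\},$$ and let $\mathcal A=\{(K,z,n,r) : \mu(K\cap N_{z\restriction n})=r\}$ and $\mathcal B=\{(K,z,r) : \mathcal D_K(z)\text{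 exists and equals } r\}$, as subsets of the same product spaces. For a Borel class $\boldsymbol\Gamma$, a subset $A$ of a Polish space $X$ is $\boldsymbol\Gamma$-hard if for every zero-dimensional Polish space $Z$ and every $B\in\boldsymbol\Gamma(Z)$ there is a continuous $f\colon Z\to X$ with $B=f^{-1}(A)$; it is $\boldsymbol\Gamma$-complete if moreover $A\in\boldsymbol\Gamma(X)$. A function is of Baire class $k$ if preimages of open sets are $\boldsymbol\Sigma^0_{k+1}$. **Theorem.** (a) For every $r\in[0,1)$ and every $z\in 2^\omega$, the section $\{K\in\mathcal K : (K,z,0,r)\in\mathcal A_{\le}\}=\{K\in\mathcal K : \mu(K)\le r\}$ is $\boldsymbol\Pi^0_2$-complete, and its complement $\{K\in\mathcal K : (K,z,0,r)\in\mathcal A_{>}\}=\{K\in\mathcal K : \mu(K)>r\}$ is $\boldsymbol\Sigma^0_2$-complete. The sets $\mathcal A_{\le}$ and $\mathcal A_{>}$ are $\boldsymbol\Pi^0_2$-complete and $\boldsymbol\Sigma^0_2$-complete, respectively, and $\mathcal A$ is $\boldsymbol\Pi^0_2$-complete. (b) $\mathcal B^-_{\le}$ is $\boldsymbol\Pi^0_2$-complete,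 $\mathcal B^-_{\ge}$ is $\boldsymbol\Pi^0_3$-complete, $\mathcal B^-_{>}$ is $\boldsymbol\Sigma^0_2$-complete and $\mathcal B^-_{<}$ is $\boldsymbol\Sigma^0_3$-complete. Moreover $\mathcal B$ is $\boldsymbol\Pi^0_3$-hard. (c) The function $2^\omega\times\mathcal K\to[0,1]$, $(z,K)\mapsto\mathcal D^-_K(z)$, is of Baire class $2$ but not of Baire class $1$. -/

import Mathlib

open MeasureTheory Filter Topology TopologicalSpace

/-! ### Borel hierarchy, hardness, completeness, Baire classes -/

/-- The finite levels of the boldface additive classes: `SigmaZero 1 X` consists of the open subsets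
of `X`, and `SigmaZero (n + 1) X` of the countable unions of complements of sets in `SigmaZero n X`,
for `n ≥ 1`. (Levels start at `1`; level `0` is void.) -/
def SigmaZero : ℕ → (X : Type) → [TopologicalSpace X] → Set (Set X)
  | 0, _, _ => ∅
  | 1, _, _ => {s | IsOpen s}
  | n + 2, X, _ =>
      {s | ∃ f : ℕ → Set X, (∀ i, (f i)ᶜ ∈ SigmaZero (n + 1) X) ∧ s = ⋃ i, f i}

/-- The finite levels of the boldface multiplicative classes: complements of sets in
`SigmaZero n X`. -/
def PiZero (n : ℕ) (X : Type) [TopologicalSpace X] : Set (Set X) :=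
  {s | sᶜ ∈ SigmaZero n X}

/-- A space is zero-dimensional if its clopen sets form a basis. -/
def IsZeroDimensional (Z : Type) [TopologicalSpace Z] : Prop :=
  IsTopologicalBasis {s : Set Z | IsClopen s}

/-- `A ⊆ X` is `Γ`-hard if every `B ∈ Γ(Z)`, for `Z` zero-dimensional Polish, is a continuous
preimage of `A`. (Every Polish space is homeomorphic to one in `Type`.) -/
def IsHardFor (Γ : (X : Type) → [TopologicalSpace X] → Set (Set X))
    {X : Type} [TopologicalSpace X] (A : Set X) : Prop :=
  ∀ (Z : Type) [TopologicalSpace Z] [PolishSpace Z], IsZeroDimensional Z →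
    ∀ B ∈ Γ Z, ∃ f : Z → X, Continuous f ∧ f ⁻¹' A = B

/-- `A ⊆ X` is `Γ`-complete if it is in `Γ(X)` and `Γ`-hard. -/
def IsCompleteFor (Γ : (X : Type) → [TopologicalSpace X] → Set (Set X))
    {X : Type} [TopologicalSpace X] (A : Set X) : Prop :=
  A ∈ Γ X ∧ IsHardFor Γ A

/-- `f` is of Baire class `n` if preimages of open sets are in the additive class `n + 1`. -/
def IsBaireClass (n : ℕ) {X Y : Type} [TopologicalSpace X] [TopologicalSpace Y] (f : X → Y) :
    Prop :=
  ∀ U : Set Y, IsOpen U → f ⁻¹' U ∈ SigmaZero (n + 1) X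

/-! ### Cantor space, the coin-tossing measure and densities

The basic open set determined by the first `n` values of `z` is `PiNat.cylinder z n`. -/

/-- The Cantor space. -/
abbrev Cantor : Type := ℕ → Bool

/-- The coin-tossing measure: the countable power of the uniform measure on `{0, 1}`. -/
noncomputable def coin : Measure Cantor :=
  Measure.infinitePi fun _ : ℕ => (PMF.uniformOfFintype Bool).toMeasure

instance : IsProbabilityMeasure coin := by
  unfold coin; infer_instance

/-- The coin-tossing measure gives mass `2⁻ⁿ` to each basic open set of length `n`. -/
theorem coin_cylinder (z : Cantor) (n : ℕ) :
    coin (PiNat.cylinder z n) = (2⁻¹ : ENNReal) ^ n := by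
  have h : PiNat.cylinder z n = Set.pi (Finset.range n : Set ℕ) fun i => {z i} := by
    ext y; simp [PiNat.cylinder]
  rw [h, coin, Measure.infinitePi_pi _ (by intros; measurability)]
  simp

/-- The relative measure of `A` in the basic open set determined by the first `n` values
of `z`. -/
noncomputable def relMeasure (A : Set Cantor) (z : Cantor) (n : ℕ) : ℝ :=
  coin.real (A ∩ PiNat.cylinder z n) / coin.real (PiNat.cylinder z n)

theorem relMeasure_mem (A : Set Cantor) (z : Cantor) (n : ℕ) :
    relMeasure A z n ∈ Set.Icc (0 : ℝ) 1 :=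
  ⟨div_nonneg measureReal_nonneg measureReal_nonneg,
    div_le_one_of_le₀ (measureReal_mono Set.inter_subset_right) measureReal_nonneg⟩

/-- `A` has density `r` at `z`. -/
def HasDensity (A : Set Cantor) (z : Cantor) (r : ℝ) : Prop :=
  Tendsto (relMeasure A z) atTop (𝓝 r)

/-- The lower density of `A` at `z`. -/
noncomputable def lowerDensity (A : Set Cantor) (z : Cantor) : ℝ :=
  liminf (relMeasure A z) atTop

theorem lowerDensity_mem (A : Set Cantor) (z : Cantor) :
    lowerDensity A z ∈ Set.Icc (0 : ℝ) 1 := by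
  have hb : IsBoundedUnder (· ≥ ·) atTop (relMeasure A z) :=
    isBoundedUnder_of ⟨0, fun n => (relMeasure_mem A z n).1⟩
  have ha : IsBoundedUnder (· ≤ ·) atTop (relMeasure A z) :=
    isBoundedUnder_of ⟨1, fun n => (relMeasure_mem A z n).2⟩
  exact ⟨le_liminf_of_le ha.isCoboundedUnder_ge
      (Eventually.of_forall fun n => (relMeasure_mem A z n).1),
    (liminf_le_limsup ha hb).trans (limsup_le_of_le hb.isCoboundedUnder_le
      (Eventually.of_forall fun n => (relMeasure_mem A z n).2))⟩

/-- The lower density as a function of the point and the compact set, with values in `[0, 1]`. -/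
noncomputable def lowerDensityMap (p : Cantor × Compacts Cantor) : unitInterval :=
  ⟨lowerDensity p.2 p.1, lowerDensity_mem p.2 p.1⟩

/-! ### The sets under study

`Compacts Cantor` carries the Vietoris topology; it contains the empty set. -/

/-- The quadruples `(K, z, n, r)` such that the measure of the part of `K` in the basic open set
determined by the first `n` values of `z` is in relation `R` to `r`. -/
def setA (R : ℝ → ℝ → Prop) : Set (Compacts Cantor × Cantor × ℕ × unitInterval) :=
  {p | R (coin.real ((p.1 : Set Cantor) ∩ PiNat.cylinder p.2.1 p.2.2.1)) p.2.2.2}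

/-- The triples `(K, z, r)` such that the lower density of `K` at `z` is in relation `R`
to `r`. -/
def setBLower (R : ℝ → ℝ → Prop) : Set (Compacts Cantor × Cantor × unitInterval) :=
  {p | R (lowerDensity p.1 p.2.1) p.2.2}

/-- The triples `(K, z, r)` such that `K` has density `r` at `z`. -/
def setB : Set (Compacts Cantor × Cantor × unitInterval) :=
  {p | HasDensity p.1 p.2.1 p.2.2}

/-!
The upper bounds come from outer regularity: `K ↦ coin (K ∩ N)` is upper semicontinuous for every
clopen `N` (`isOpen_coin_lt`). Hence `coin (K ∩ N) ≤ r` is a `Gδ` condition, and the bounds for the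
lower density follow by counting quantifiers in the definition of the lower limit.

For hardness, two canonical sets suffice. Over a zero-dimensional space a `Gδ` set is the set of
points at which infinitely many of a sequence of clopen events happen, so the set of infinite subsets
of `ℕ` is `Π⁰₂`-hard (`isHardFor_infinite`). Doing this for each of countably many `Gδ` sets shows
that the set of sequences of natural numbers that tend to infinity is `Π⁰₃`-hard
(`isHardFor_tendsto_atTop`). These sets are then reduced to the sets of the theorem.

* Let `C` be compact of measure exactly `r < 1`, and let `w ∉ C`. For `E ⊆ ℕ`, the points close
  enough to `w` that agree with `w` on `E` form a compact set disjoint from `C`. It is null if `E` is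
  infinite, and has interior if `E` is finite. So its union with `C` has measure `≤ r` exactly when
  `E` is infinite (`isHardFor_coin_le`).
* For `φ : ℕ → ℕ`, let `perforated φ` be the complement of the cylinders of `0ᵐ 1 0 … 0` with `φ m`
  zeros after the `1`. At the zero sequence it has density `1` exactly when `φ` tends to infinity
  (`hasDensity_perforated_iff`). If `φ m = 0` for infinitely many `m`, the lower density there is at
  most `1 / 2`, which separates the infinite sets `E` from the finite ones when `φ` vanishes on `E`
  and is the identity elsewhere.

Both families depend continuously on their parameter, since the initial segments of length `n` of
the points of the compact set depend only on finitely many values of the parameter. Restricted to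
the second family with `φ` given by `E`, a lower density function of Baire class `1` would make the
finite sets and the infinite sets two disjoint dense `Gδ` subsets of the Cantor space.
-/

/-! ### The low levels of the Borel hierarchy -/

section Hierarchy

variable {X : Type} [TopologicalSpace X]

theorem mem_sigmaZero_two_iff {s : Set X} :
    s ∈ SigmaZero 2 X ↔ ∃ f : ℕ → Set X, (∀ i, IsClosed (f i)) ∧ s = ⋃ i, f i := by
  simp only [SigmaZero, Set.mem_ofPred_eq, isOpen_compl_iff]

theorem mem_piZero_two_iff {s : Set X} : s ∈ PiZero 2 X ↔ IsGδ s := by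
  rw [PiZero, Set.mem_ofPred_eq, mem_sigmaZero_two_iff, isGδ_iff_eq_iInter_nat]
  constructor
  · rintro ⟨f, hf, h⟩
    exact ⟨fun i => (f i)ᶜ, fun i => (hf i).isOpen_compl, by
      rw [← Set.compl_iUnion, ← h, compl_compl]⟩
  · rintro ⟨f, hf, rfl⟩
    exact ⟨fun i => (f i)ᶜ, fun i => (hf i).isClosed_compl, by rw [Set.compl_iInter]⟩

theorem compl_mem_piZero_iff {n : ℕ} {s : Set X} : sᶜ ∈ PiZero n X ↔ s ∈ SigmaZero n X := by
  rw [PiZero, Set.mem_ofPred_eq, compl_compl]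

theorem mem_sigmaZero_three_iff {s : Set X} :
    s ∈ SigmaZero 3 X ↔ ∃ f : ℕ → Set X, (∀ i, IsGδ (f i)) ∧ s = ⋃ i, f i := by
  simp only [← mem_piZero_two_iff]
  rfl

theorem sigmaZero_three_iUnion {ι : Type*} [Countable ι] {f : ι → Set X}
    (hf : ∀ i, f i ∈ SigmaZero 3 X) : ⋃ i, f i ∈ SigmaZero 3 X := by
  rcases isEmpty_or_nonempty ι with _ | _
  · exact mem_sigmaZero_three_iff.2 ⟨fun _ => ∅, fun _ => isOpen_empty.isGδ, by simp⟩
  choose g hg hfg using fun i => mem_sigmaZero_three_iff.1 (hf i)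
  obtain ⟨e, he⟩ := exists_surjective_nat (ι × ℕ)
  refine mem_sigmaZero_three_iff.2 ⟨fun n => g (e n).1 (e n).2, fun n => hg _ _, ?_⟩
  rw [he.iUnion_comp fun p : ι × ℕ => g p.1 p.2, Set.iUnion_prod']
  exact Set.iUnion_congr hfg

theorem IsGδ.mem_sigmaZero_three {s : Set X} (hs : IsGδ s) : s ∈ SigmaZero 3 X :=
  mem_sigmaZero_three_iff.2 ⟨fun _ => s, fun _ => hs, (Set.iUnion_const s).symm⟩

theorem inter_mem_sigmaZero_three {s t : Set X} (hs : s ∈ SigmaZero 3 X)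
    (ht : t ∈ SigmaZero 3 X) : s ∩ t ∈ SigmaZero 3 X := by
  obtain ⟨f, hf, rfl⟩ := mem_sigmaZero_three_iff.1 hs
  obtain ⟨g, hg, rfl⟩ := mem_sigmaZero_three_iff.1 ht
  rw [Set.iUnion_inter_iUnion]
  exact sigmaZero_three_iUnion fun i => sigmaZero_three_iUnion fun j =>
    ((hf i).inter (hg j)).mem_sigmaZero_three

theorem IsHardFor.compl_sigmaZero {n : ℕ} {A : Set X} (h : IsHardFor (PiZero n) A) :
    IsHardFor (SigmaZero n) Aᶜ := by
  intro Z _ _ hZ B hB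
  obtain ⟨f, hf, hfB⟩ := h Z hZ Bᶜ (compl_mem_piZero_iff.2 hB)
  exact ⟨f, hf, by rw [Set.preimage_compl, hfB, compl_compl]⟩

theorem IsCompleteFor.compl_sigmaZero {n : ℕ} {A : Set X} (h : IsCompleteFor (PiZero n) A) :
    IsCompleteFor (SigmaZero n) Aᶜ :=
  ⟨h.1, h.2.compl_sigmaZero⟩

theorem IsHardFor.of_preimage {Γ : (X : Type) → [TopologicalSpace X] → Set (Set X)}
    {Y : Type} [TopologicalSpace Y] {A : Set X} {D : Set Y} (hD : IsHardFor Γ D) {g : Y → X}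
    (hg : Continuous g) (h : ∀ y, g y ∈ A ↔ y ∈ D) : IsHardFor Γ A := by
  intro Z _ _ hZ B hB
  obtain ⟨f, hf, rfl⟩ := hD Z hZ B hB
  exact ⟨g ∘ f, hg.comp hf, Set.ext fun z => h (f z)⟩

end Hierarchy

/-! ### Two canonical hard sets -/

section Canonical

variable {Z : Type} [TopologicalSpace Z]

theorem IsZeroDimensional.exists_disjoint_clopen_iUnion [SecondCountableTopology Z]
    (hZ : IsZeroDimensional Z) {U : Set Z} (hU : IsOpen U) :
    ∃ W : ℕ → Set Z, (∀ k, IsClopen (W k)) ∧ Pairwise (Function.onFun Disjoint W) ∧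
      U = ⋃ k, W k := by
  obtain ⟨S, hS, hSU⟩ := hZ.open_eq_sUnion hU
  obtain ⟨T, hTc, hTS, hTU⟩ := isOpen_sUnion_countable S fun s hs => (hS hs).isOpen
  obtain ⟨V, hV⟩ : ∃ V : ℕ → Set Z, insert ∅ T = Set.range V :=
    (hTc.insert ∅).exists_eq_range (Set.insert_nonempty _ _)
  have hVc : ∀ k, IsClopen (V k) := fun k => by
    have hk : V k ∈ insert ∅ T := hV ▸ Set.mem_range_self k
    rcases hk with hk | hk
    · rw [hk]; exact isClopen_empty
    · exact hS (hTS hk)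
  refine ⟨disjointed V, fun k => ?_, disjoint_disjointed V, ?_⟩
  · exact disjointedRec (fun _ _ ht => ht.diff (hVc _)) (hVc k)
  · rw [iUnion_disjointed, ← Set.sUnion_range, ← hV, Set.sUnion_insert, Set.empty_union, hTU, hSU]

/-- A `Gδ` subset of a zero-dimensional space can be written as the set of points lying in infinitely
many terms of a sequence of clopen sets: if `G` is the intersection of a decreasing sequence of open
sets `O j`, and each `O j` is partitioned into clopen pieces, then a point lies in exactly one piece
for each `j` with `x ∈ O j`. -/
theorem IsZeroDimensional.exists_continuous_infinite_iff [SecondCountableTopology Z]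
    (hZ : IsZeroDimensional Z) {G : Set Z} (hG : IsGδ G) :
    ∃ e : Z → Cantor, Continuous e ∧ ∀ x, x ∈ G ↔ {n | e x n = true}.Infinite := by
  classical
  obtain ⟨f, hf, rfl⟩ := isGδ_iff_eq_iInter_nat.1 hG
  have hO : ∀ j, IsOpen (⋂ i ∈ Finset.range (j + 1), f i) := fun j =>
    isOpen_biInter_finset fun i _ => hf i
  choose W hWc hWd hW using fun j => hZ.exists_disjoint_clopen_iUnion (hO j)
  refine ⟨fun x n => decide (x ∈ W n.unpair.1 n.unpair.2), ?_, fun x => ?_⟩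
  · refine continuous_pi fun n => ?_
    exact (continuous_boolIndicator_iff_isClopen (W n.unpair.1 n.unpair.2)).2 (hWc _ _)
  have hmem : ∀ j, (∀ i ≤ j, x ∈ f i) ↔ ∃ k, x ∈ W j k := fun j => by
    rw [← Set.mem_iUnion, ← hW j]
    simp
  simp only [decide_eq_true_eq, Set.mem_iInter]
  constructor
  · intro hx
    choose k hk using fun j => (hmem j).1 fun i _ => hx i
    refine Set.infinite_of_injective_forall_mem (f := fun j => Nat.pair j (k j)) ?_ ?_
    · intro a b hab
      simpa using congrArg (fun n => n.unpair.1) hab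
    · intro j
      simpa using hk j
  · intro hinf
    by_contra! hx
    obtain ⟨i, hi⟩ := hx
    refine hinf (Set.Finite.of_finite_image ((Set.finite_Iio i).subset ?_) ?_
      (f := fun n => n.unpair.1))
    · rintro _ ⟨n, hn, rfl⟩
      by_contra hle
      exact hi ((hmem _).2 ⟨_, hn⟩ i (not_lt.1 hle))
    · intro a ha b hb hab
      have h2 : a.unpair.2 = b.unpair.2 := by
        by_contra hne
        refine Set.disjoint_left.1 (hWd a.unpair.1 hne) ha ?_
        have hb' : x ∈ W b.unpair.1 b.unpair.2 := hb
        rwa [← (show a.unpair.1 = b.unpair.1 from hab)] at hb'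
      rw [← Nat.pair_unpair a, ← Nat.pair_unpair b, h2, show a.unpair.1 = b.unpair.1 from hab]

end Canonical

theorem isHardFor_infinite : IsHardFor (PiZero 2) {E : Cantor | {n | E n = true}.Infinite} := by
  intro Z _ _ hZ B hB
  obtain ⟨e, he, h⟩ := hZ.exists_continuous_infinite_iff (mem_piZero_two_iff.1 hB)
  exact ⟨e, he, Set.ext fun x => (h x).symm⟩

/-- The sequences of natural numbers that tend to infinity form a `Π⁰₃`-hard set. If the complement
of `B` is the union of `Gδ` sets `G i`, and `x ∈ G i` means that infinitely many events of row `i`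
happen at `x`, then the sequence that takes the value `i` at an event of row `i`, and is large
elsewhere, tends to infinity exactly when every row has finitely many events. -/
theorem isHardFor_tendsto_atTop :
    IsHardFor (PiZero 3) {φ : ℕ → ℕ | Tendsto φ atTop atTop} := by
  intro Z _ _ hZ B hB
  obtain ⟨G, hG, hBG⟩ := mem_sigmaZero_three_iff.1 hB
  choose e he h using fun i => hZ.exists_continuous_infinite_iff (hG i)
  let φ : Z → ℕ → ℕ := fun x n => if e n.unpair.1 x n.unpair.2 = true then n.unpair.1 else n
  refine ⟨φ, continuous_pi fun n => ?_, Set.ext fun x => ?_⟩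
  · exact continuous_of_discreteTopology.comp ((continuous_apply n.unpair.2).comp (he n.unpair.1))
      (g := fun b : Bool => if b = true then n.unpair.1 else n)
  have hx : x ∈ B ↔ ∀ i, {n | e i x n = true}.Finite := by
    rw [← Set.notMem_compl_iff, hBG]
    simp [h, Set.not_infinite]
  rw [hx, Set.mem_preimage, Set.mem_ofPred_eq]
  constructor
  · intro ht i
    have hfin : {n | φ x n ≤ i}.Finite := by
      have := (ht.eventually_gt_atTop i)
      rw [← Nat.cofinite_eq_atTop, eventually_cofinite] at this
      simpa using this
    refine Set.Finite.of_finite_image (hfin.subset ?_) (f := fun k => Nat.pair i k)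
      fun a _ b _ hab => by simpa using hab
    rintro _ ⟨k, hk, rfl⟩
    have hk' : e i x k = true := hk
    simp [φ, hk']
  · intro hfin
    rw [← Nat.cofinite_eq_atTop, Nat.cofinite_eq_atTop, tendsto_atTop]
    intro c
    rw [← Nat.cofinite_eq_atTop, eventually_cofinite]
    have hU : ((⋃ i ∈ Set.Iio c, (fun k => Nat.pair i k) '' {n | e i x n = true}) ∪
        Set.Iio c).Finite :=
      ((Set.finite_Iio c).biUnion fun i _ => (hfin i).image _).union (Set.finite_Iio c)
    refine hU.subset fun n hn => ?_
    have hn' : φ x n < c := not_le.1 hn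
    by_cases hev : e n.unpair.1 x n.unpair.2 = true
    · left
      simp only [φ, hev, if_true] at hn'
      refine Set.mem_biUnion (Set.mem_Iio.2 hn') ⟨n.unpair.2, hev, Nat.pair_unpair n⟩
    · right
      simpa [φ, hev] using hn'

/-! ### Complexity of the measure and of the lower density -/

theorem isClopen_cylinder (z : Cantor) (n : ℕ) : IsClopen (PiNat.cylinder z n) := by
  refine ⟨?_, PiNat.isOpen_cylinder _ z n⟩
  rw [PiNat.cylinder_eq_pi]
  exact isClosed_set_pi fun _ _ => isClosed_discrete _

theorem coin_real_cylinder (z : Cantor) (n : ℕ) :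
    coin.real (PiNat.cylinder z n) = (2⁻¹ : ℝ) ^ n := by
  simp [Measure.real, coin_cylinder]

theorem relMeasure_eq (A : Set Cantor) (z : Cantor) (n : ℕ) :
    relMeasure A z n = coin.real (A ∩ PiNat.cylinder z n) * 2 ^ n := by
  rw [relMeasure, coin_real_cylinder, inv_pow, div_inv_eq_mul]

theorem isBoundedUnder_ge_relMeasure (A : Set Cantor) (z : Cantor) :
    IsBoundedUnder (· ≥ ·) atTop (relMeasure A z) :=
  isBoundedUnder_of ⟨0, fun n => (relMeasure_mem A z n).1⟩

theorem isBoundedUnder_le_relMeasure (A : Set Cantor) (z : Cantor) :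
    IsBoundedUnder (· ≤ ·) atTop (relMeasure A z) :=
  isBoundedUnder_of ⟨1, fun n => (relMeasure_mem A z n).2⟩

/-- The measure is upper semicontinuous on compact sets, by outer regularity. -/
theorem isOpen_coin_lt {X : Type} [TopologicalSpace X] {K : X → Compacts Cantor} {z : X → Cantor}
    {n : X → ℕ} {c : X → ℝ} (hK : Continuous K) (hz : Continuous z) (hn : Continuous n)
    (hc : Continuous c) :
    IsOpen {x | coin.real ((K x : Set Cantor) ∩ PiNat.cylinder (z x) (n x)) < c x} := by
  rw [isOpen_iff_mem_nhds]
  intro x hx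
  rw [Set.mem_ofPred_eq] at hx
  obtain ⟨q, hq, hqc⟩ := exists_between hx
  have hlt : coin ((K x : Set Cantor) ∩ PiNat.cylinder (z x) (n x)) < ENNReal.ofReal q :=
    (ENNReal.lt_ofReal_iff_toReal_lt (measure_ne_top _ _)).2 hq
  obtain ⟨U, hKU, hU, hUq⟩ := Set.exists_isOpen_lt_of_lt _ _ hlt
  have hV : IsOpen (U ∪ (PiNat.cylinder (z x) (n x))ᶜ) :=
    hU.union (isClopen_cylinder _ _).compl.isOpen
  have h1 : ∀ᶠ y in 𝓝 x, (K y : Set Cantor) ⊆ U ∪ (PiNat.cylinder (z x) (n x))ᶜ :=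
    ((Compacts.isOpen_subsets_of_isOpen hV).preimage hK).mem_nhds fun a ha => by
      by_cases h : a ∈ PiNat.cylinder (z x) (n x)
      · exact Or.inl (hKU ⟨ha, h⟩)
      · exact Or.inr h
  have h2 : ∀ᶠ y in 𝓝 x, z y ∈ PiNat.cylinder (z x) (n x) :=
    ((PiNat.isOpen_cylinder _ (z x) (n x)).preimage hz).mem_nhds (PiNat.self_mem_cylinder _ _)
  have h3 : ∀ᶠ y in 𝓝 x, n y = n x := 
    ((isOpen_discrete {n x}).preimage hn).mem_nhds rfl
  filter_upwards [h1, h2, h3, hc.continuousAt.eventually (eventually_gt_nhds hqc)]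
    with y hy1 hy2 hy3 hy4
  refine lt_trans ?_ hy4
  refine (ENNReal.lt_ofReal_iff_toReal_lt (measure_ne_top _ _)).1 ?_
  refine lt_of_le_of_lt (measure_mono ?_) hUq
  rintro a ⟨haK, hac⟩
  rw [hy3, PiNat.mem_cylinder_iff_eq.1 hy2] at hac
  exact (hy1 haK).resolve_right fun h => h hac

theorem isOpen_relMeasure_lt {X : Type} [TopologicalSpace X] {K : X → Compacts Cantor}
    {z : X → Cantor} {c : X → ℝ} (hK : Continuous K) (hz : Continuous z) (hc : Continuous c)
    (n : ℕ) : IsOpen {x | relMeasure (K x) (z x) n < c x} := by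
  have h := isOpen_coin_lt hK hz (continuous_const (y := n)) (hc.div_const (2 ^ n))
  simpa only [relMeasure_eq, lt_div_iff₀ (pow_pos (zero_lt_two' ℝ) n)] using h

theorem le_iff_forall_lt_add_one_div {a b : ℝ} :
    a ≤ b ↔ ∀ k : ℕ, a < b + 1 / ((k : ℝ) + 1) := by
  refine ⟨fun h k => lt_add_of_le_of_pos h Nat.one_div_pos_of_nat, fun h => ?_⟩
  refine le_of_forall_pos_lt_add fun ε hε => ?_
  obtain ⟨k, hk⟩ := exists_nat_one_div_lt hε
  exact (h k).trans (by linarith)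

theorem lowerDensity_le_iff {A : Set Cantor} {z : Cantor} {r : ℝ} :
    lowerDensity A z ≤ r ↔
      ∀ k m : ℕ, ∃ n ≥ m, relMeasure A z n < r + 1 / ((k : ℝ) + 1) := by
  have hco := (isBoundedUnder_le_relMeasure A z).isCoboundedUnder_ge
  have hb := isBoundedUnder_ge_relMeasure A z
  constructor
  · intro h k
    exact frequently_atTop.1
      (frequently_lt_of_liminf_lt hco (le_iff_forall_lt_add_one_div.1 h k))
  · intro h
    refine le_of_forall_pos_le_add fun ε hε => ?_
    obtain ⟨k, hk⟩ := exists_nat_one_div_lt hε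
    refine (liminf_le_of_frequently_le ?_ hb)
    exact (frequently_atTop.2 (h k)).mono fun n hn => hn.le.trans (by linarith)

theorem lt_lowerDensity_iff {A : Set Cantor} {z : Cantor} {r : ℝ} :
    r < lowerDensity A z ↔
      ∃ k m : ℕ, ∀ n ≥ m, r + 1 / ((k : ℝ) + 1) ≤ relMeasure A z n := by
  rw [← not_le, lowerDensity_le_iff]
  push Not
  rfl

theorem le_lowerDensity_iff {A : Set Cantor} {z : Cantor} {r : ℝ} :
    r ≤ lowerDensity A z ↔
      ∀ k : ℕ, ∃ m : ℕ, ∀ n ≥ m, r - 1 / ((k : ℝ) + 1) ≤ relMeasure A z n := by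
  have hco := (isBoundedUnder_le_relMeasure A z).isCoboundedUnder_ge
  have hb := isBoundedUnder_ge_relMeasure A z
  constructor
  · intro h k
    have hlt : r - 1 / ((k : ℝ) + 1) < lowerDensity A z :=
      (sub_lt_self r Nat.one_div_pos_of_nat).trans_le h
    obtain ⟨m, hm⟩ := eventually_atTop.1 (eventually_lt_of_lt_liminf hlt hb)
    exact ⟨m, fun n hn => (hm n hn).le⟩
  · intro h
    rw [le_iff_forall_lt_add_one_div]
    intro k
    have hk : (1 : ℝ) / ((k + 1 : ℕ) + 1) < 1 / (k + 1) := by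
      apply one_div_lt_one_div_of_lt
      · positivity
      · push_cast; linarith
    have : r - 1 / ((k + 1 : ℕ) + 1) ≤ lowerDensity A z :=
      le_liminf_of_le hco (eventually_atTop.2 (h (k + 1)))
    linarith

section Membership

variable {X : Type} [TopologicalSpace X] {K : X → Compacts Cantor} {z : X → Cantor} {c : X → ℝ}

theorem isGδ_coin_le {n : X → ℕ} (hK : Continuous K) (hz : Continuous z) (hn : Continuous n)
    (hc : Continuous c) :
    IsGδ {x | coin.real ((K x : Set Cantor) ∩ PiNat.cylinder (z x) (n x)) ≤ c x} := by
  simp only [le_iff_forall_lt_add_one_div (b := c _), Set.ofPred_forall]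
  exact IsGδ.iInter fun k => (isOpen_coin_lt hK hz hn (hc.add continuous_const)).isGδ

theorem isGδ_lowerDensity_le (hK : Continuous K) (hz : Continuous z) (hc : Continuous c) :
    IsGδ {x | lowerDensity (K x) (z x) ≤ c x} := by
  simp only [lowerDensity_le_iff, Set.ofPred_forall, Set.ofPred_exists]
  refine IsGδ.iInter fun k => IsGδ.iInter fun m => IsOpen.isGδ (isOpen_iUnion fun n => ?_)
  exact isOpen_const.inter (isOpen_relMeasure_lt hK hz (hc.add continuous_const) n)

theorem lowerDensity_lt_mem_sigmaZero_three (hK : Continuous K) (hz : Continuous z)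
    (hc : Continuous c) : {x | lowerDensity (K x) (z x) < c x} ∈ SigmaZero 3 X := by
  simp only [← not_le (b := lowerDensity _ _), le_lowerDensity_iff, not_forall, not_exists,
    Set.ofPred_forall, Set.ofPred_exists, not_le]
  refine sigmaZero_three_iUnion fun k => IsGδ.mem_sigmaZero_three (IsGδ.iInter fun m =>
    IsOpen.isGδ (isOpen_iUnion fun n => isOpen_iUnion fun _ => ?_))
  exact isOpen_relMeasure_lt hK hz (hc.sub continuous_const) n

theorem lt_lowerDensity_mem_sigmaZero_three [MetrizableSpace X] (hK : Continuous K)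
    (hz : Continuous z) (hc : Continuous c) :
    {x | c x < lowerDensity (K x) (z x)} ∈ SigmaZero 3 X := by
  let := metrizableSpaceMetric X
  simp only [lt_lowerDensity_iff, Set.ofPred_forall, Set.ofPred_exists]
  refine sigmaZero_three_iUnion fun k => sigmaZero_three_iUnion fun m =>
    IsGδ.mem_sigmaZero_three (IsGδ.iInter fun n => IsGδ.iInter fun _ => IsClosed.isGδ ?_)
  simp only [← not_lt]
  exact (isOpen_relMeasure_lt hK hz (hc.add continuous_const) n).isClosed_compl

end Membership

instance : MetrizableSpace (Compacts Cantor) := metrizableSpace_of_t3_secondCountable _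

theorem isBaireClass_two_lowerDensityMap : IsBaireClass 2 lowerDensityMap := by
  intro U hU
  obtain ⟨V, hV, rfl⟩ := isOpen_induced_iff.1 hU
  have hK : Continuous fun p : Cantor × Compacts Cantor => p.2 := continuous_snd
  obtain ⟨S, hSc, hSU⟩ : ∃ S : Set (ℚ × ℚ), S.Countable ∧
      V = ⋃ q ∈ S, Set.Ioo (q.1 : ℝ) q.2 := by
    refine ⟨{q | Set.Ioo (q.1 : ℝ) q.2 ⊆ V}, Set.to_countable _, ?_⟩
    refine Set.Subset.antisymm (fun x hx => ?_) (Set.iUnion₂_subset fun q hq => hq)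
    obtain ⟨_, hs, hxs, hsV⟩ := Real.isTopologicalBasis_Ioo_rat.exists_subset_of_mem_open hx hV
    simp only [Set.mem_iUnion, Set.mem_singleton_iff] at hs
    obtain ⟨a, b, _, rfl⟩ := hs
    exact Set.mem_biUnion (x := (a, b)) hsV hxs
  have := hSc.to_subtype
  rw [hSU, Set.biUnion_eq_iUnion, Set.preimage_iUnion, Set.preimage_iUnion]
  refine sigmaZero_three_iUnion fun q => ?_
  exact inter_mem_sigmaZero_three
    (lt_lowerDensity_mem_sigmaZero_three hK continuous_fst continuous_const)
    (lowerDensity_lt_mem_sigmaZero_three hK continuous_fst continuous_const)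

/-! ### Compact sets depending continuously on a parameter -/

/-- A compact-valued map is continuous for the Vietoris topology as soon as, for every `n`, the set
of initial segments of length `n` of points of its value is locally constant. -/
theorem continuous_compacts_of_eventually {Z : Type} [TopologicalSpace Z] {K : Z → Compacts Cantor}
    (h : ∀ x n, ∀ᶠ x' in 𝓝 x,
      (∀ y ∈ K x, ∃ y' ∈ K x', y' ∈ PiNat.cylinder y n) ∧
      ∀ y' ∈ K x', ∃ y ∈ K x, y ∈ PiNat.cylinder y' n) :
    Continuous K := by
  refine continuous_induced_rng.2 (continuous_generateFrom_iff.2 ?_)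
  have hcyl : ∀ (V : Set Cantor), IsOpen V → ∀ y ∈ V, ∃ n, PiNat.cylinder y n ⊆ V := by
    intro V hV y hy
    obtain ⟨_, ⟨z, n, rfl⟩, hyz, hzV⟩ :=
      (PiNat.isTopologicalBasis_cylinders fun _ : ℕ => Bool).exists_subset_of_mem_open hy hV
    exact ⟨n, by rwa [PiNat.mem_cylinder_iff_eq.1 hyz]⟩
  rintro _ (⟨U, hU, rfl⟩ | ⟨V, hV, rfl⟩)
  · rw [isOpen_iff_mem_nhds]
    intro x hx
    obtain ⟨n, hn⟩ : ∃ n, ∀ y ∈ (K x : Set Cantor), PiNat.cylinder y n ⊆ U := by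
      refine (K x).isCompact.induction_on (p := fun S => ∃ n, ∀ y ∈ S, PiNat.cylinder y n ⊆ U)
        ⟨0, by simp⟩ (fun s t hst ⟨n, hn⟩ => ⟨n, fun y hy => hn y (hst hy)⟩) ?_ ?_
      · rintro s t ⟨n, hn⟩ ⟨m, hm⟩
        refine ⟨max n m, fun y hy => ?_⟩
        rcases hy with hy | hy
        · exact (PiNat.cylinder_anti y (le_max_left n m)).trans (hn y hy)
        · exact (PiNat.cylinder_anti y (le_max_right n m)).trans (hm y hy)
      · intro y hy
        obtain ⟨n, hn⟩ := hcyl U hU y (hx hy)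
        refine ⟨PiNat.cylinder y n, mem_nhdsWithin_of_mem_nhds
          ((PiNat.isOpen_cylinder _ y n).mem_nhds (PiNat.self_mem_cylinder y n)), n, ?_⟩
        intro y' hy'
        rwa [PiNat.mem_cylinder_iff_eq.1 hy']
    filter_upwards [h x n] with x' hx' y' hy'
    obtain ⟨y, hy, hyy'⟩ := hx'.2 y' hy'
    exact hn y hy ((PiNat.mem_cylinder_comm _ _ _).1 hyy')
  · rw [isOpen_iff_mem_nhds]
    rintro x ⟨y, hy, hyV⟩
    obtain ⟨n, hn⟩ := hcyl V hV y hyV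
    filter_upwards [h x n] with x' hx'
    obtain ⟨y', hy', hyy'⟩ := hx'.1 y hy
    exact ⟨y', hy', hn hyy'⟩

/-- The compact set of points that agree with `w` at every coordinate in the set coded by `E`. -/
def pinned (w E : Cantor) : Compacts Cantor where
  carrier := {y | ∀ i, E i = true → y i = w i}
  isCompact' := by
    refine IsClosed.isCompact ?_
    simp only [Set.ofPred_forall]
    exact isClosed_iInter fun i => isClosed_iInter fun _ =>
      isClosed_eq (continuous_apply i) continuous_const

theorem continuous_pinned (w : Cantor) : Continuous (pinned w) := by
  have key : ∀ (E E' : Cantor) (n : ℕ), E' ∈ PiNat.cylinder E n →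
      ∀ y ∈ pinned w E, ∃ y' ∈ pinned w E', y' ∈ PiNat.cylinder y n := by
    intro E E' n hE y hy
    refine ⟨fun i => if i < n then y i else w i, fun i hi => ?_, fun i hi => if_pos hi⟩
    by_cases hin : i < n
    · simp only [hin, if_true]
      exact hy i ((hE i hin).symm.trans hi)
    · simp only [hin, if_false]
  refine continuous_compacts_of_eventually fun E n => ?_
  filter_upwards [(PiNat.isOpen_cylinder _ E n).mem_nhds (PiNat.self_mem_cylinder E n)] with E' hE'
  exact ⟨key E E' n hE', key E' E n ((PiNat.mem_cylinder_comm _ _ _).1 hE')⟩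

theorem coin_pinned_eq_zero {w E : Cantor} (hE : {i | E i = true}.Infinite) :
    coin (pinned w E : Set Cantor) = 0 := by
  refine le_antisymm (ge_of_tendsto' (ENNReal.tendsto_pow_atTop_nhds_zero_of_lt_one
    (r := 2⁻¹) (by simp)) fun n => ?_) zero_le
  obtain ⟨F, hF, hFn⟩ := hE.exists_subset_card_eq n
  have hsub : (pinned w E : Set Cantor) ⊆ Set.pi (F : Set ℕ) fun i => {w i} := by
    intro y hy i hi
    exact hy i (hF hi)
  refine (measure_mono hsub).trans ?_
  rw [coin, Measure.infinitePi_pi _ (by intros; measurability)]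
  simp [hFn]

theorem cylinder_subset_pinned {w E : Cantor} {N : ℕ} (h : ∀ i, E i = true → i < N) :
    PiNat.cylinder w N ⊆ pinned w E := fun _ hy i hi => hy i (h i hi)

/-- The cylinder of the sequence `0ᵐ 1 0ᵏ`. -/
def hole (m k : ℕ) : Set Cantor := PiNat.cylinder (fun j => decide (j = m)) (m + 1 + k)

theorem isClopen_hole (m k : ℕ) : IsClopen (hole m k) := isClopen_cylinder _ _

theorem coin_hole (m k : ℕ) : coin (hole m k) = (2⁻¹ : ENNReal) ^ (m + 1 + k) := coin_cylinder _ _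

theorem apply_of_mem_hole {m k i : ℕ} {y : Cantor} (hy : y ∈ hole m k) (hi : i ≤ m) :
    y i = decide (i = m) := hy i (by omega)

theorem disjoint_hole {m m' k k' : ℕ} (h : m ≠ m') : Disjoint (hole m k) (hole m' k') := by
  wlog hlt : m < m' generalizing m m' k k'
  · exact (this h.symm (by omega)).symm
  refine Set.disjoint_left.2 fun y hy hy' => ?_
  have h1 := apply_of_mem_hole hy le_rfl
  have h2 := apply_of_mem_hole hy' hlt.le
  simp [h1, h] at h2

/-- The Cantor space with a hole at `0ᵐ 1 0 … 0` for every `m`, where the number of zeros after the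
`1` is `φ m`. -/
def perforated (φ : ℕ → ℕ) : Compacts Cantor where
  carrier := (⋃ m, hole m (φ m))ᶜ
  isCompact' := (isOpen_iUnion fun _ => (isClopen_hole _ _).isOpen).isClosed_compl.isCompact

theorem mem_perforated {φ : ℕ → ℕ} {y : Cantor} :
    y ∈ perforated φ ↔ ∀ m, y ∉ hole m (φ m) := by
  change y ∈ (⋃ m, hole m (φ m))ᶜ ↔ _
  simp

theorem continuous_perforated : Continuous perforated := by
  have key : ∀ (φ φ' : ℕ → ℕ) (n : ℕ), φ' ∈ PiNat.cylinder φ n →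
      ∀ y ∈ perforated φ, ∃ y' ∈ perforated φ', y' ∈ PiNat.cylinder y n := by
    intro φ φ' n hφ y hy
    rw [mem_perforated] at hy
    by_cases hy0 : ∀ i < n, y i = false
    · -- the zero sequence avoids every hole
      refine ⟨fun _ => false, mem_perforated.2 fun m hm => ?_, fun i hi => (hy0 i hi).symm⟩
      simpa using apply_of_mem_hole hm le_rfl
    · -- the only hole that `y` could meet is determined by the first `n` values
      push Not at hy0
      obtain ⟨i, hin, hi⟩ := hy0
      refine ⟨y, mem_perforated.2 fun m hm => ?_, PiNat.self_mem_cylinder y n⟩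
      have hmi : m ≤ i := by
        by_contra hlt
        exact hi ((apply_of_mem_hole hm (by omega)).trans (by simp; omega))
      rw [hφ m (by omega)] at hm
      exact hy m hm
  refine continuous_compacts_of_eventually fun φ n => ?_
  filter_upwards [(PiNat.isOpen_cylinder _ φ n).mem_nhds (PiNat.self_mem_cylinder φ n)] with φ' hφ'
  exact ⟨key φ φ' n hφ', key φ' φ n ((PiNat.mem_cylinder_comm _ _ _).1 hφ')⟩

/-! ### Compact sets of prescribed measure -/

/-- Every `r ∈ [0, 1]` is the measure of a compact set: the complement of the union of the cylinders
`0ᵐ 1`, for `m` in the set of binary digits `1` of `1 - r`. -/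
theorem exists_compacts_coin_eq (r : unitInterval) :
    ∃ C : Compacts Cantor, coin.real (C : Set Cantor) = r := by
  obtain ⟨d, -, hd⟩ := Real.ofDigits_SurjOn one_lt_two (unitInterval.symm r).2
  let S : ℕ → Set Cantor := fun m => if d m = 1 then hole m 0 else ∅
  have hSo : ∀ m, IsOpen (S m) := fun m => by
    by_cases h : d m = 1 <;> simp [S, h, (isClopen_hole m 0).isOpen]
  have hSc : ∀ m, coin (S m) = ENNReal.ofReal (Real.ofDigitsTerm d m) := fun m => by
    by_cases h : d m = 1
    · simp [S, h, coin_hole, Real.ofDigitsTerm, ENNReal.ofReal_inv_of_pos, ENNReal.ofReal_pow,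
        ENNReal.inv_pow]
    · have h0 : d m = 0 := by omega
      simp [S, h0, Real.ofDigitsTerm]
  have hSd : Pairwise (Function.onFun Disjoint S) := fun m m' h => by
    refine Set.disjoint_of_subset ?_ ?_ (disjoint_hole (k := 0) (k' := 0) h) <;>
      (simp only [S]; split_ifs <;> simp)
  have hS : coin.real (⋃ m, S m) = 1 - r := by
    rw [Measure.real, measure_iUnion hSd fun m => (hSo m).measurableSet]
    simp only [hSc]
    rw [← ENNReal.ofReal_tsum_of_nonneg (fun _ => Real.ofDigitsTerm_nonneg)
      Real.summable_ofDigitsTerm]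
    change (ENNReal.ofReal (Real.ofDigits d)).toReal = _
    rw [hd, ENNReal.toReal_ofReal (unitInterval.nonneg _), unitInterval.coe_symm_eq]
  refine ⟨⟨(⋃ m, S m)ᶜ, (isOpen_iUnion hSo).isClosed_compl.isCompact⟩, ?_⟩
  change coin.real (⋃ m, S m)ᶜ = r
  rw [probReal_compl_eq_one_sub (isOpen_iUnion hSo).measurableSet, hS, sub_sub_cancel]

theorem isHardFor_coin_le {r : unitInterval} (hr : r < 1) :
    IsHardFor (PiZero 2) {K : Compacts Cantor | coin.real (K : Set Cantor) ≤ r} := by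
  obtain ⟨C, hC⟩ := exists_compacts_coin_eq r
  have hr' : (r : ℝ) < 1 := hr
  obtain ⟨w, hw⟩ : ∃ w, w ∉ (C : Set Cantor) := by
    by_contra! h
    rw [Set.eq_univ_of_forall h, probReal_univ] at hC
    exact hr'.ne' hC
  obtain ⟨_, ⟨z, N, rfl⟩, hwz, hzC⟩ :=
    (PiNat.isTopologicalBasis_cylinders fun _ : ℕ => Bool).exists_subset_of_mem_open
      (show w ∈ (C : Set Cantor)ᶜ from hw) C.isCompact.isClosed.isOpen_compl
  rw [← PiNat.mem_cylinder_iff_eq.1 hwz] at hzC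
  refine isHardFor_infinite.of_preimage
    (g := fun E => C ⊔ pinned w (fun i => E i || decide (i < N))) ?_ fun E => ?_
  · exact continuous_const.sup ((continuous_pinned w).comp (continuous_pi fun i =>
      continuous_of_discreteTopology.comp (continuous_apply i)
        (g := fun b : Bool => b || decide (i < N))))
  rw [Set.mem_ofPred_eq, Set.mem_ofPred_eq, Compacts.coe_sup]
  constructor
  · intro h hfin
    -- if `E` is finite, the second set contains a cylinder that is disjoint from `C`
    obtain ⟨M, hM⟩ := (hfin : Set.Finite _).bddAbove
    have hsub : PiNat.cylinder w (max N (M + 1)) ⊆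
        pinned w (fun i => E i || decide (i < N)) := by
      refine cylinder_subset_pinned fun i hi => ?_
      rcases (Bool.or_eq_true _ _).mp hi with hi | hi
      · exact lt_max_of_lt_right (Nat.lt_succ_of_le (hM hi))
      · exact lt_max_of_lt_left (of_decide_eq_true hi)
    have hdis : Disjoint (C : Set Cantor) (PiNat.cylinder w (max N (M + 1))) :=
      (Set.disjoint_left.2 fun y hy hy' =>
        hzC (PiNat.cylinder_anti w (le_max_left _ _) hy') hy)
    have hle := measureReal_mono (μ := coin) (Set.union_subset_union_right (C : Set Cantor) hsub)
    rw [measureReal_union hdis (isClopen_cylinder _ _).isOpen.measurableSet, coin_real_cylinder, hC]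
      at hle
    have : (0 : ℝ) < 2⁻¹ ^ max N (M + 1) := by positivity
    linarith
  · intro hE
    refine (measureReal_union_le _ _).trans ?_
    have h0 := coin_pinned_eq_zero (w := w) (E := fun i => E i || decide (i < N))
      (hE.mono fun i (hi : E i = true) => by simp [hi])
    rw [measureReal_def, measureReal_def, h0, ← measureReal_def, hC, ENNReal.toReal_zero, add_zero]

/-! ### The density at the zero sequence -/

/-- The zero sequence. -/
def zeroSeq : Cantor := fun _ => false

theorem relMeasure_perforated_le (φ : ℕ → ℕ) (m : ℕ) :
    relMeasure (perforated φ) zeroSeq m ≤ 1 - (2⁻¹ : ℝ) ^ (φ m + 1) := by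
  have hsub : hole m (φ m) ⊆ PiNat.cylinder zeroSeq m := fun y hy i hi => by
    simpa [hi.ne, zeroSeq] using apply_of_mem_hole hy hi.le
  have h1 : (perforated φ : Set Cantor) ∩ PiNat.cylinder zeroSeq m ⊆
      PiNat.cylinder zeroSeq m \ hole m (φ m) := fun y hy =>
    ⟨hy.2, mem_perforated.1 hy.1 m⟩
  have h2 := measureReal_mono (μ := coin) h1
  rw [measureReal_sdiff hsub (isClopen_hole _ _).isOpen.measurableSet, coin_real_cylinder, hole,
    coin_real_cylinder] at h2
  rw [relMeasure, coin_real_cylinder, div_le_iff₀ (by positivity)]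
  refine h2.trans (le_of_eq ?_)
  ring

theorem le_relMeasure_perforated {φ : ℕ → ℕ} {n c : ℕ} (h : ∀ m ≥ n, c ≤ φ m) :
    1 - (2⁻¹ : ℝ) ^ c ≤ relMeasure (perforated φ) zeroSeq n := by
  have hsub : PiNat.cylinder zeroSeq n \ perforated φ ⊆ ⋃ k, hole (n + k) (φ (n + k)) := by
    rintro y ⟨hyn, hy⟩
    obtain ⟨m, hm⟩ : ∃ m, y ∈ hole m (φ m) := by
      by_contra! hno
      exact hy (mem_perforated.2 hno)
    have hnm : n ≤ m := by
      by_contra hlt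
      have h1 := apply_of_mem_hole hm le_rfl
      simp [hyn m (by omega), zeroSeq] at h1
    obtain ⟨k, rfl⟩ := Nat.exists_eq_add_of_le hnm
    exact Set.mem_iUnion.2 ⟨k, hm⟩
  have hdiff : coin (PiNat.cylinder zeroSeq n \ perforated φ) ≤ 2⁻¹ ^ (n + c) := by
    calc coin (PiNat.cylinder zeroSeq n \ perforated φ)
        ≤ ∑' k, coin (hole (n + k) (φ (n + k))) := (measure_mono hsub).trans (measure_iUnion_le _)
      _ ≤ ∑' k : ℕ, 2⁻¹ ^ (n + c) * 2⁻¹ ^ (k + 1) := by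
          refine ENNReal.tsum_le_tsum fun k => ?_
          rw [coin_hole, ← pow_add]
          refine pow_le_pow_right_of_le_one' (by simp) ?_
          have := h (n + k) (by omega)
          omega
      _ = 2⁻¹ ^ (n + c) := by
          rw [ENNReal.tsum_mul_left, ENNReal.tsum_geometric_add_one]
          simp [ENNReal.inv_mul_cancel]
  have hreal : coin.real (PiNat.cylinder zeroSeq n \ perforated φ) ≤ (2⁻¹ : ℝ) ^ (n + c) := by
    have := ENNReal.toReal_mono (by simp) hdiff
    simpa [Measure.real] using this
  have hsum := measureReal_inter_add_sdiff (μ := coin) (s := PiNat.cylinder zeroSeq n)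
    (perforated φ).isCompact.isClosed.measurableSet
  rw [coin_real_cylinder, Set.inter_comm] at hsum
  rw [relMeasure, coin_real_cylinder, le_div_iff₀ (by positivity)]
  rw [pow_add] at hreal
  linarith

theorem hasDensity_one_iff {A : Set Cantor} {z : Cantor} :
    HasDensity A z 1 ↔ 1 ≤ lowerDensity A z := by
  refine ⟨fun h => h.liminf_eq.ge, fun h => ?_⟩
  have ha := isBoundedUnder_le_relMeasure A z
  have hb := isBoundedUnder_ge_relMeasure A z
  exact tendsto_of_le_liminf_of_limsup_le h (limsup_le_of_le hb.isCoboundedUnder_le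
    (Eventually.of_forall fun n => (relMeasure_mem A z n).2)) ha hb

theorem hasDensity_perforated_iff {φ : ℕ → ℕ} :
    HasDensity (perforated φ) zeroSeq 1 ↔ Tendsto φ atTop atTop := by
  constructor
  · intro h
    refine tendsto_atTop.2 fun c => ?_
    have hlt : 1 - (2⁻¹ : ℝ) ^ c < 1 := sub_lt_self _ (by positivity)
    filter_upwards [h.eventually (lt_mem_nhds hlt)] with m hm
    by_contra hc
    have hpow : (2⁻¹ : ℝ) ^ c ≤ 2⁻¹ ^ (φ m + 1) :=
      pow_le_pow_of_le_one (by norm_num) (by norm_num) (by omega)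
    linarith [relMeasure_perforated_le φ m]
  · intro h
    refine hasDensity_one_iff.2 (le_lowerDensity_iff.2 fun k => ?_)
    obtain ⟨c, hc⟩ := exists_pow_lt_of_lt_one (show (0 : ℝ) < 1 / ((k : ℝ) + 1) by positivity)
      (show (2⁻¹ : ℝ) < 1 by norm_num)
    obtain ⟨m, hm⟩ := eventually_atTop.1 (h.eventually_ge_atTop c)
    exact ⟨m, fun n hn => le_trans (by linarith)
      (le_relMeasure_perforated fun i hi => hm i (hn.trans hi))⟩

/-- The sequence that vanishes on the set coded by `E` and is the identity elsewhere. -/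
def killOn (E : Cantor) : ℕ → ℕ := fun m => if E m = true then 0 else m

theorem continuous_killOn : Continuous killOn :=
  continuous_pi fun m => continuous_of_discreteTopology.comp (continuous_apply m)
    (g := fun b : Bool => if b = true then 0 else m)

theorem lowerDensity_killOn_le {E : Cantor} (hE : {n | E n = true}.Infinite) :
    lowerDensity (perforated (killOn E)) zeroSeq ≤ 1 / 2 := by
  refine liminf_le_of_frequently_le ?_ (isBoundedUnder_ge_relMeasure _ _)
  refine (Nat.frequently_atTop_iff_infinite.2 hE).mono fun m hm => ?_
  refine (relMeasure_perforated_le _ m).trans ?_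
  simp only [killOn, hm, if_true]
  norm_num

theorem lowerDensity_killOn_eq_one {E : Cantor} (hE : {n | E n = true}.Finite) :
    lowerDensity (perforated (killOn E)) zeroSeq = 1 := by
  refine (hasDensity_perforated_iff.2 (tendsto_id.congr' ?_)).liminf_eq
  have : ∀ᶠ m in atTop, E m ≠ true := by
    rw [← Nat.cofinite_eq_atTop]
    exact hE.eventually_cofinite_notMem
  filter_upwards [this] with m hm
  simp [killOn, hm]

/-! ### Completeness, and the Baire class -/

theorem isCompleteFor_coin_le {r : unitInterval} (hr : r < 1) :
    IsCompleteFor (PiZero 2) {K : Compacts Cantor | coin.real (K : Set Cantor) ≤ r} := by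
  refine ⟨mem_piZero_two_iff.2 ?_, isHardFor_coin_le hr⟩
  have h := isGδ_coin_le (X := Compacts Cantor) continuous_id (continuous_const (y := zeroSeq))
    (continuous_const (y := 0)) (continuous_const (y := (r : ℝ)))
  simpa only [PiNat.cylinder_zero, Set.inter_univ, id] using h

theorem isGδ_setA_le : IsGδ (setA (· ≤ ·)) :=
  isGδ_coin_le continuous_fst (continuous_fst.comp continuous_snd)
    (continuous_fst.comp (continuous_snd.comp continuous_snd))
    (continuous_subtype_val.comp (continuous_snd.comp (continuous_snd.comp continuous_snd)))

theorem isClosed_setA_ge : IsClosed (setA (· ≥ ·)) := by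
  have h := (isOpen_coin_lt (X := Compacts Cantor × Cantor × ℕ × unitInterval) continuous_fst
    (continuous_fst.comp continuous_snd) (continuous_fst.comp (continuous_snd.comp continuous_snd))
    (continuous_subtype_val.comp
      (continuous_snd.comp (continuous_snd.comp continuous_snd)))).isClosed_compl
  simp only [Set.compl_ofPred, not_lt] at h
  exact h

theorem isGδ_setA_eq : IsGδ (setA (· = ·)) := by
  let := metrizableSpaceMetric (Compacts Cantor × Cantor × ℕ × unitInterval)
  have h : setA (· = ·) = setA (· ≤ ·) ∩ setA (· ≥ ·) := Set.ext fun _ => le_antisymm_iff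
  rw [h]
  exact isGδ_setA_le.inter isClosed_setA_ge.isGδ

theorem compl_setA_le : (setA (· ≤ ·))ᶜ = setA (· > ·) := by
  simp [setA, Set.compl_ofPred]

theorem compl_setBLower_le : (setBLower (· ≤ ·))ᶜ = setBLower (· > ·) := by
  simp [setBLower, Set.compl_ofPred]

theorem compl_setBLower_ge : (setBLower (· ≥ ·))ᶜ = setBLower (· < ·) := by
  simp [setBLower, Set.compl_ofPred]

theorem isCompleteFor_setA_le : IsCompleteFor (PiZero 2) (setA (· ≤ ·)) := by
  refine ⟨mem_piZero_two_iff.2 isGδ_setA_le, (isHardFor_coin_le (r := 0) zero_lt_one).of_preimage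
    (g := fun K => (K, zeroSeq, 0, 0)) (by fun_prop) fun K => ?_⟩
  simp [setA]

theorem isCompleteFor_setA_eq : IsCompleteFor (PiZero 2) (setA (· = ·)) := by
  refine ⟨mem_piZero_two_iff.2 isGδ_setA_eq, (isHardFor_coin_le (r := 0) zero_lt_one).of_preimage
    (g := fun K => (K, zeroSeq, 0, 0)) (by fun_prop) fun K => ?_⟩
  simp [setA, measureReal_nonneg.ge_iff_eq']

theorem isCompleteFor_setBLower_le : IsCompleteFor (PiZero 2) (setBLower (· ≤ ·)) := by
  refine ⟨mem_piZero_two_iff.2 (isGδ_lowerDensity_le continuous_fst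
    (continuous_fst.comp continuous_snd)
    (continuous_subtype_val.comp (continuous_snd.comp continuous_snd))), ?_⟩
  let r : unitInterval := ⟨1 / 2, by norm_num, by norm_num⟩
  refine isHardFor_infinite.of_preimage (g := fun E => (perforated (killOn E), zeroSeq, r))
    ((continuous_perforated.comp continuous_killOn).prodMk continuous_const) fun E => ?_
  change lowerDensity (perforated (killOn E)) zeroSeq ≤ 1 / 2 ↔ _
  refine ⟨fun h hfin => ?_, lowerDensity_killOn_le⟩
  rw [lowerDensity_killOn_eq_one hfin] at h
  norm_num at h

theorem isHardFor_setB : IsHardFor (PiZero 3) setB :=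
  isHardFor_tendsto_atTop.of_preimage (g := fun φ => (perforated φ, zeroSeq, 1))
    (continuous_perforated.prodMk continuous_const) fun _ => hasDensity_perforated_iff

theorem isCompleteFor_setBLower_ge : IsCompleteFor (PiZero 3) (setBLower (· ≥ ·)) := by
  refine ⟨?_, ?_⟩
  · rw [PiZero, Set.mem_ofPred_eq, compl_setBLower_ge]
    exact lowerDensity_lt_mem_sigmaZero_three continuous_fst (continuous_fst.comp continuous_snd)
      (continuous_subtype_val.comp (continuous_snd.comp continuous_snd))
  · exact isHardFor_tendsto_atTop.of_preimage (g := fun φ => (perforated φ, zeroSeq, 1))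
      (continuous_perforated.prodMk continuous_const) fun _ =>
        hasDensity_one_iff.symm.trans hasDensity_perforated_iff

theorem IsBaireClass.isGδ_preimage {X Y : Type} [TopologicalSpace X] [TopologicalSpace Y]
    {f : X → Y} (hf : IsBaireClass 1 f) {F : Set Y} (hF : IsClosed F) : IsGδ (f ⁻¹' F) := by
  rw [← mem_piZero_two_iff, PiZero, Set.mem_ofPred_eq, ← Set.preimage_compl]
  exact hf _ hF.isOpen_compl

/-- The sequences that are eventually equal to `b` are dense in the Cantor space. -/
theorem dense_of_forall_eventually_const {D : Set Cantor} (b : Bool)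
    (hD : ∀ E : Cantor, (∀ᶠ n in atTop, E n = b) → E ∈ D) : Dense D := by
  intro E
  rw [(PiNat.isTopologicalBasis_cylinders fun _ : ℕ => Bool).mem_closure_iff]
  rintro _ ⟨z, n, rfl⟩ hE
  refine ⟨fun i => if i < n then z i else b, fun i hi => if_pos hi, hD _ ?_⟩
  filter_upwards [eventually_ge_atTop n] with i hi
  simp [hi.not_gt]

/-- On a copy of the Cantor space, the lower density is `1` at the finite sets and at most `1 / 2` at
the infinite ones. For a function of Baire class `1` these would be two disjoint dense `Gδ` sets,
against the Baire category theorem. -/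
theorem not_isBaireClass_one_lowerDensityMap : ¬ IsBaireClass 1 lowerDensityMap := by
  intro h
  let g : Cantor → Cantor × Compacts Cantor := fun E => (zeroSeq, perforated (killOn E))
  have hg : Continuous g :=
    continuous_const.prodMk (continuous_perforated.comp continuous_killOn)
  let d : Cantor → ℝ := fun E => lowerDensityMap (g E)
  have hGδ : ∀ F : Set ℝ, IsClosed F → IsGδ (d ⁻¹' F) := fun F hF => by
    have hF' := (h.isGδ_preimage (hF.preimage continuous_subtype_val)).preimage hg
    exact hF'
  have h1 : Dense (d ⁻¹' {1}) := dense_of_forall_eventually_const false fun E hE => by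
    refine lowerDensity_killOn_eq_one ?_
    rw [← Nat.cofinite_eq_atTop, eventually_cofinite] at hE
    simpa using hE
  have h2 : Dense (d ⁻¹' Set.Iic (1 / 2)) := dense_of_forall_eventually_const true fun E hE =>
    lowerDensity_killOn_le (Nat.frequently_atTop_iff_infinite.1 hE.frequently)
  obtain ⟨E, hE1, hE2⟩ :=
    (h1.inter_of_Gδ (hGδ _ isClosed_singleton) (hGδ _ isClosed_Iic) h2).nonempty
  have hE1' : d E = 1 := hE1
  have hE2' : d E ≤ 1 / 2 := hE2
  linarith

theorem mainTheorem12 :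
    -- sections of the `A` sets at `n = 0` and a fixed `r < 1`
    (∀ r : unitInterval, r < 1 → ∀ z : Cantor,
      {K : Compacts Cantor | (K, z, 0, r) ∈ setA (· ≤ ·)} =
        {K : Compacts Cantor | coin.real (K : Set Cantor) ≤ r} ∧
      {K : Compacts Cantor | (K, z, 0, r) ∈ setA (· > ·)} =
        {K : Compacts Cantor | coin.real (K : Set Cantor) > r} ∧
      IsCompleteFor (PiZero 2) {K : Compacts Cantor | (K, z, 0, r) ∈ setA (· ≤ ·)} ∧
      IsCompleteFor (SigmaZero 2) {K : Compacts Cantor | (K, z, 0, r) ∈ setA (· > ·)}) ∧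
    -- the `A` sets
    IsCompleteFor (PiZero 2) (setA (· ≤ ·)) ∧
    IsCompleteFor (SigmaZero 2) (setA (· > ·)) ∧
    IsCompleteFor (PiZero 2) (setA (· = ·)) ∧
    -- the `B` sets
    IsCompleteFor (PiZero 2) (setBLower (· ≤ ·)) ∧
    IsCompleteFor (PiZero 3) (setBLower (· ≥ ·)) ∧
    IsCompleteFor (SigmaZero 2) (setBLower (· > ·)) ∧
    IsCompleteFor (SigmaZero 3) (setBLower (· < ·)) ∧
    IsHardFor (PiZero 3) setB ∧
    -- the Baire class of the lower density function
    IsBaireClass 2 lowerDensityMap ∧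
    ¬ IsBaireClass 1 lowerDensityMap := by
  refine ⟨fun r hr z => ?_, isCompleteFor_setA_le, compl_setA_le ▸
    isCompleteFor_setA_le.compl_sigmaZero, isCompleteFor_setA_eq, isCompleteFor_setBLower_le,
    isCompleteFor_setBLower_ge, compl_setBLower_le ▸ isCompleteFor_setBLower_le.compl_sigmaZero,
    compl_setBLower_ge ▸ isCompleteFor_setBLower_ge.compl_sigmaZero, isHardFor_setB,
    isBaireClass_two_lowerDensityMap, not_isBaireClass_one_lowerDensityMap⟩
  have hle : {K : Compacts Cantor | (K, z, 0, r) ∈ setA (· ≤ ·)} =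
      {K : Compacts Cantor | coin.real (K : Set Cantor) ≤ r} := by
    simp [setA]
  have hgt : {K : Compacts Cantor | (K, z, 0, r) ∈ setA (· > ·)} =
      {K : Compacts Cantor | coin.real (K : Set Cantor) > r} := by
    simp [setA]
  have hc : {K : Compacts Cantor | coin.real (K : Set Cantor) ≤ r}ᶜ =
      {K : Compacts Cantor | coin.real (K : Set Cantor) > r} := by
    simp [Set.compl_ofPred]
  refine ⟨hle, hgt, hle ▸ isCompleteFor_coin_le hr, ?_⟩
  rw [hgt, ← hc]
  exact (isCompleteFor_coin_le hr).compl_sigmaZero
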